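/- There is a constant $c>0$ such that for all constants $K\in\mathbb{R}$ and $k\in\mathbb{N}$ there are a constant $\eta>0$ and an $N\in\mathbb{N}$, depending only on $K$ and $k$, with the following property. Let $f:\mathbb{N}\to\mathbb{R}$, and let $n\ge N$ be such that $c\ln n\le f(n)\le K(\ln n)^k$ and $f(n)\le n$. Each node $v$ of the complete graph $K_n$ includes each color $x\in\{1,\dots,n\}$ in a list $S_v$ with probability $f(n)/n$, independently over all pairs $(v,x)$. Let $G$ be the sparsified graph: the spanning subgraph of $K_n$ whose edges are the pairs $\{u,v\}$ of distinct nodes with $S_u\cap S_v\ne\emptyset$. Consider any randomized $\mathsf{LOCAL}$ algorithm on $G$: nodes have unique identifiers, which do not depend on the lists; every node initially knows $n$, its own identifier, the identifiers of its neighbors in $G$, its list $S_v$ and a private random string, where the random strings are i.i.d. with an arbitrary law and independent of the lists; in each synchronous round every node sends a message of unbounded size to each of its neighbors in $G$, and local computation is unbounded. If after $T$ rounds the colors output by the nodes form, with probability at least $2/3$ over the lists and the random strings, a proper coloring of $K_n$ in which every node $v$ has a color from $S_v$, then $$T\ \ge\ \eta\cdot\frac{\ln n}{\ln\ln n}.$$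 In other words, $\Omega(\log n/\log\log n)$ rounds are needed, even with unbounded message sizes. -/

import Mathlib

open MeasureTheory ProbabilityTheory

namespace PaletteSparsification

universe u v w

/-- The sparsification of `G` by the color lists `S`: keep the edges of `G` whose endpoints have
a common color in their lists. -/
def sparsified {V C : Type*} (G : SimpleGraph V) (S : V → Set C) : SimpleGraph V where
  Adj a b := G.Adj a b ∧ (S a ∩ S b).Nonempty
  symm := ⟨fun _ _ h => ⟨h.1.symm, by rw [Set.inter_comm]; exact h.2⟩⟩
  loopless := ⟨fun _ h => G.irrefl h.1⟩

/-- `col` is a proper coloring of `G` that gives every node a color from its own list. -/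
def IsListColoring {V C : Type*} (G : SimpleGraph V) (S : V → Set C) (col : V → C) : Prop :=
  (∀ a, col a ∈ S a) ∧ ∀ a b, G.Adj a b → col a ≠ col b

/-- A randomized algorithm in the `LOCAL` model. All nodes run the same code in synchronous rounds;
the types of states and messages and all the functions are arbitrary, so message sizes and local
computation are unbounded. A node starts knowing its identifier, the identifiers of its neighbors,
its private input and its private random string (an element of `Coin`). -/
structure LocalAlgorithm (Input Output : Type*) (Coin : Type u) (State : Type v)
    (Msg : Type w) where
  /-- Initial state, from the node's own identifier, the set of the identifiers of its neighbors,
  its input and its random string. -/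
  init : ℕ → Set ℕ → Input → Coin → State
  /-- The message that a node in a given state sends to the neighbor with a given identifier. -/
  send : State → ℕ → Msg
  /-- The new state, from the old one and the messages received in the round, each of them tagged
  with the identifier of its sender. -/
  receive : State → Set (ℕ × Msg) → State
  /-- The output of a node that stops in a given state. -/
  output : State → Output

namespace LocalAlgorithm

variable {V Input Output : Type*} {Coin : Type u} {State : Type v} {Msg : Type w}

/-- The state of each node after `t` rounds of communication over the edges of `H`, where `ident`
gives the identifiers, `inp` the inputs and `r` the random strings. -/
def stateAfter (A : LocalAlgorithm Input Output Coin State Msg) (H : SimpleGraph V)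
    (ident : V → ℕ) (inp : V → Input) (r : V → Coin) : ℕ → V → State
  | 0 => fun a => A.init (ident a) (ident '' H.neighborSet a) (inp a) (r a)
  | t + 1 => fun a =>
      A.receive (A.stateAfter H ident inp r t a)
        {m | ∃ b, H.Adj a b ∧ m = (ident b, A.send (A.stateAfter H ident inp r t b) (ident a))}

/-- The outputs of the nodes when the algorithm is stopped after `T` rounds. -/
def run (A : LocalAlgorithm Input Output Coin State Msg) (H : SimpleGraph V)
    (ident : V → ℕ) (inp : V → Input) (r : V → Coin) (T : ℕ) : V → Output :=
  fun a => A.output (A.stateAfter H ident inp r T a)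

end LocalAlgorithm

/-- The law of the color lists and the random strings on `n` nodes: every color of `Fin n` is in the
list of every node with probability `p`, every random string has law `ρ`, all independently. -/
noncomputable def sampleLaw (n : ℕ) (p : unitInterval) {Coin : Type u} [MeasurableSpace Coin]
    (ρ : Measure Coin) : Measure ((Fin n → Set (Fin n)) × (Fin n → Coin)) :=
  (Measure.pi fun _ : Fin n => setBernoulli (Set.univ : Set (Fin n)) p).prod
    (Measure.pi fun _ : Fin n => ρ)

/-- The event that the algorithm, run for `T` rounds on the sparsified complete graph with the
sampled lists as inputs, outputs a proper coloring of the complete graph from these lists. -/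
def successEvent {n : ℕ} {Coin : Type u} {State : Type v} {Msg : Type w}
    (A : LocalAlgorithm (Set (Fin n)) (Fin n) Coin State Msg) (ident : Fin n → ℕ) (T : ℕ) :
    Set ((Fin n → Set (Fin n)) × (Fin n → Coin)) :=
  {ω | IsListColoring (⊤ : SimpleGraph (Fin n)) ω.1
    (A.run (sparsified (⊤ : SimpleGraph (Fin n)) ω.1) ident ω.1 ω.2 T)}

end PaletteSparsification

open scoped ENNReal Nat

namespace PaletteSparsification

/-- The nodes at distance at most `t` from `v`. -/
def ball {V : Type*} (H : SimpleGraph V) (v : V) : ℕ → Set V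
  | 0 => {v}
  | t + 1 => {w | w ∈ ball H v t ∨ ∃ u ∈ ball H v t, H.Adj u w}

section Ball

variable {V : Type*} {H H' : SimpleGraph V} {v u w : V} {s t : ℕ}

lemma ball_mono (h : s ≤ t) : ball H v s ⊆ ball H v t := by
  induction h with
  | refl => exact subset_rfl
  | step _ ih => exact fun x hx => Or.inl (ih hx)

lemma self_mem_ball : v ∈ ball H v t := ball_mono (Nat.zero_le t) rfl

lemma mem_ball_succ (hu : u ∈ ball H v t) (h : H.Adj u w) : w ∈ ball H v (t + 1) :=
  Or.inr ⟨u, hu, h⟩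

/-- A node far from `v` in two graphs that differ only at `v` ends up in the same state. -/
lemma stateAfter_eq_of_notMem_ball {Input Output Coin State Msg : Type*}
    (A : LocalAlgorithm Input Output Coin State Msg) (ident : V → ℕ) {inp inp' : V → Input}
    (r : V → Coin) (hinp : ∀ a ≠ v, inp a = inp' a)
    (hadj : ∀ a ≠ v, ∀ b ≠ v, (H.Adj a b ↔ H'.Adj a b))
    (hw : w ∉ ball H v (t + 1)) (hw' : w ∉ ball H' v (t + 1)) :
    A.stateAfter H ident inp r t w = A.stateAfter H' ident inp' r t w := by
  have key : ∀ {w : V} {t : ℕ}, w ∉ ball H v (t + 1) → w ∉ ball H' v (t + 1) →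
      ∀ b, (H.Adj w b ↔ H'.Adj w b) := by
    intro w t hw hw' b
    have hwv : w ≠ v := fun h => hw (h ▸ self_mem_ball)
    rcases eq_or_ne b v with rfl | hb
    · exact ⟨fun h => (hw (mem_ball_succ self_mem_ball h.symm)).elim,
        fun h => (hw' (mem_ball_succ self_mem_ball h.symm)).elim⟩
    · exact hadj w hwv b hb
  induction t generalizing w with
  | zero =>
    have hwv : w ≠ v := fun h => hw (h ▸ self_mem_ball)
    have hn : H.neighborSet w = H'.neighborSet w := Set.ext (key hw hw')
    simp only [LocalAlgorithm.stateAfter, hn, hinp w hwv]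
  | succ t ih =>
    have hs := ih (fun h => hw (Or.inl h)) (fun h => hw' (Or.inl h))
    simp only [LocalAlgorithm.stateAfter, hs]
    congr 1
    ext m
    refine exists_congr fun b => ?_
    rw [key hw hw' b]
    refine and_congr_right fun hb => ?_
    rw [ih (fun h => hw (mem_ball_succ h ((key hw hw' b).2 hb).symm))
      (fun h => hw' (mem_ball_succ h hb.symm))]

end Ball

section Resampling

variable {V C : Type*} {S S' : V → Set C} {v w : V}

/-- If the new list of `v` has no color in common with the lists near `v`, then its old and its new
neighborhoods are far apart. -/
lemma notMem_ball_of_resampled (hS : ∀ a ≠ v, S a = S' a) {M : ℕ}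
    (hgood : ∀ u ∈ ball (sparsified ⊤ S) v M, Disjoint (S' v) (S u)) {s t : ℕ} (hst : s + t ≤ M)
    (hwv : w ≠ v) (hw : w ∈ ball (sparsified ⊤ S') v t) : w ∉ ball (sparsified ⊤ S) v s := by
  induction t generalizing s w with
  | zero => exact (hwv hw).elim
  | succ t ih =>
    rcases hw with hw | ⟨u, hu, huw⟩
    · exact ih (by omega) hwv hw
    · rcases eq_or_ne u v with rfl | huv
      · intro h
        have := hgood w (ball_mono (by omega) h)
        rw [Set.disjoint_iff_inter_eq_empty, hS w hwv] at this
        exact huw.2.ne_empty this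
      · intro h
        refine ih (s := s + 1) (by omega) huv hu (mem_ball_succ h ⟨huw.1.symm, ?_⟩)
        rw [hS u huv, hS w hwv, Set.inter_comm]
        exact huw.2

/-- A local algorithm cannot color properly both before and after resampling the list of a single
node, unless the new list meets the old lists near that node. -/
lemma not_isListColoring_of_resampled [Finite V] {Coin State Msg : Type*}
    (A : LocalAlgorithm (Set V) V Coin State Msg) (ident : V → ℕ) (r : V → Coin) (T : ℕ)
    {S S' : V → Set V} (hS : ∀ a ≠ v, S a = S' a)
    (hgood : ∀ u ∈ ball (sparsified ⊤ S) v (2 * T + 3), Disjoint (S' v) (S u))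
    (h : IsListColoring ⊤ S (A.run (sparsified ⊤ S) ident S r T)) :
    ¬ IsListColoring ⊤ S' (A.run (sparsified ⊤ S') ident S' r T) := by
  intro h'
  set c := A.run (sparsified ⊤ S) ident S r T with hc
  set c' := A.run (sparsified ⊤ S') ident S' r T with hc'
  have inj : Function.Injective c := fun a b hab => by
    by_contra hne
    exact h.2 a b hne hab
  have inj' : Function.Injective c' := fun a b hab => by
    by_contra hne
    exact h'.2 a b hne hab
  have surj' : Function.Surjective c' := Finite.injective_iff_surjective.1 inj'
  have hadj : ∀ a ≠ v, ∀ b ≠ v,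
      ((sparsified (⊤ : SimpleGraph V) S).Adj a b ↔ (sparsified ⊤ S').Adj a b) := by
    intro a ha b hb
    simp only [sparsified, hS a ha, hS b hb]
  choose g hg using fun u => surj' (c u)
  set B := ball (sparsified ⊤ S) v (T + 1) with hB
  have maps : ∀ u ∈ B, g u ∈ B \ {v} := by
    intro u hu
    have hcu : c u ∈ S u := h.1 u
    have hgu : c u ∈ S' (g u) := hg u ▸ h'.1 (g u)
    have hgv : g u ≠ v := by
      intro e
      rw [e] at hgu
      exact Set.disjoint_left.1 (hgood u (ball_mono (by omega) hu)) hgu hcu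
    refine ⟨?_, hgv⟩
    by_contra hgB
    by_cases hgB' : g u ∈ ball (sparsified ⊤ S') v (T + 1)
    · refine notMem_ball_of_resampled hS hgood (s := T + 2) (by omega) hgv hgB' ?_
      refine mem_ball_succ hu ⟨fun e => hgB (e ▸ hu), c u, hcu, ?_⟩
      rwa [hS _ hgv]
    · have : c (g u) = c' (g u) := by
        simp only [hc, hc', LocalAlgorithm.run]
        rw [stateAfter_eq_of_notMem_ball A ident r hS hadj hgB hgB']
      rw [hg u] at this
      exact hgB (by rw [inj this]; exact hu)
  have ginj : Function.Injective g := fun a b hab => inj (by rw [← hg a, ← hg b, hab])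
  have h1 : B.ncard ≤ (B \ {v}).ncard :=
    Set.ncard_le_ncard_of_injOn g maps ginj.injOn (Set.toFinite _)
  exact absurd h1 (not_le.2 (Set.ncard_sdiff_singleton_lt_of_mem self_mem_ball (Set.toFinite _)))

end Resampling

section Degrees

variable {V C : Type*} [Finite V] [Finite C] {S : V → Set C} {D : ℕ}

lemma ncard_biUnion_le_mul {α β : Type*} [Finite α] [Finite β] (s : Set α) (F : α → Set β)
    (hF : ∀ a ∈ s, (F a).ncard ≤ D) : (⋃ a ∈ s, F a).ncard ≤ s.ncard * D := by
  classical
  have := Fintype.ofFinite α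
  have := Fintype.ofFinite β
  have hs : s.ncard = s.toFinset.card := Set.ncard_eq_toFinset_card' s
  have hU : (⋃ a ∈ s, F a) = ((s.toFinset.biUnion fun a => (F a).toFinset : Finset β) : Set β) := by
    ext; simp
  rw [hU, Set.ncard_coe_finset, hs]
  refine Finset.card_biUnion_le_card_mul _ _ _ fun a ha => ?_
  rw [← Set.ncard_eq_toFinset_card']
  exact hF a (by simpa using ha)

lemma ncard_ball_le (hrow : ∀ a, (S a).ncard ≤ D) (hcol : ∀ x, {a | x ∈ S a}.ncard ≤ D)
    (v : V) (t : ℕ) : (ball (sparsified ⊤ S) v t).ncard ≤ (1 + D ^ 2) ^ t := by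
  induction t with
  | zero => simp [ball]
  | succ t ih =>
    set B := ball (sparsified ⊤ S) v t
    have hsub : ball (sparsified ⊤ S) v (t + 1) ⊆ B ∪ ⋃ u ∈ B, ⋃ x ∈ S u, {a | x ∈ S a} := by
      rintro w (hw | ⟨u, hu, -, x, hxu, hxw⟩)
      · exact Or.inl hw
      · exact Or.inr (by simp only [Set.mem_iUnion]; exact ⟨u, hu, x, hxu, hxw⟩)
    have h2 : (⋃ u ∈ B, ⋃ x ∈ S u, {a | x ∈ S a}).ncard ≤ B.ncard * (D * D) :=
      ncard_biUnion_le_mul _ _ fun u _ =>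
        (ncard_biUnion_le_mul _ _ fun x _ => hcol x).trans (Nat.mul_le_mul_right _ (hrow u))
    calc (ball (sparsified ⊤ S) v (t + 1)).ncard
        ≤ _ := Set.ncard_le_ncard hsub (Set.toFinite _)
      _ ≤ B.ncard + B.ncard * (D * D) := (Set.ncard_union_le _ _).trans (by omega)
      _ = B.ncard * (1 + D ^ 2) := by ring
      _ ≤ (1 + D ^ 2) ^ (t + 1) := by rw [pow_succ]; exact Nat.mul_le_mul_right _ ih

lemma ncard_colors_near_le (hrow : ∀ a, (S a).ncard ≤ D) (hcol : ∀ x, {a | x ∈ S a}.ncard ≤ D)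
    (v : V) (t : ℕ) : (⋃ u ∈ ball (sparsified ⊤ S) v t, S u).ncard ≤ (1 + D ^ 2) ^ t * D :=
  (ncard_biUnion_le_mul _ _ fun u _ => hrow u).trans
    (Nat.mul_le_mul_right _ (ncard_ball_le hrow hcol v t))

end Degrees

/-- A union bound for many simultaneous events. -/
lemma measure_le_ncard_le {Ω ι : Type*} [MeasurableSpace Ω] [Fintype ι] (μ : Measure Ω)
    (E : ι → Set Ω) (q : ℝ≥0∞) (hE : ∀ F : Finset ι, μ (⋂ i ∈ F, E i) ≤ q ^ F.card) (D : ℕ) :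
    μ {ω | D ≤ {i | ω ∈ E i}.ncard} ≤ (Fintype.card ι).choose D * q ^ D := by
  classical
  have hsub : {ω | D ≤ {i | ω ∈ E i}.ncard} ⊆
      ⋃ F ∈ (Finset.univ : Finset ι).powersetCard D, ⋂ i ∈ F, E i := by
    intro ω hω
    have hω' : D ≤ ({i | ω ∈ E i} : Set ι).toFinset.card := by
      rw [← Set.ncard_eq_toFinset_card']; exact hω
    obtain ⟨F, hF, hFD⟩ := Finset.exists_subset_card_eq hω'
    simp only [Set.mem_iUnion, Set.mem_iInter]
    refine ⟨F, by simp [Finset.mem_powersetCard, hFD], fun i hi => ?_⟩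
    simpa using hF hi
  refine (measure_mono hsub).trans ((measure_biUnion_finset_le _ _).trans ?_)
  calc ∑ F ∈ (Finset.univ : Finset ι).powersetCard D, μ (⋂ i ∈ F, E i)
      ≤ ∑ F ∈ (Finset.univ : Finset ι).powersetCard D, q ^ D :=
        Finset.sum_le_sum fun F hF => (Finset.mem_powersetCard.1 hF).2 ▸ hE F
    _ = (Fintype.card ι).choose D * q ^ D := by
        rw [Finset.sum_const, Finset.card_powersetCard, Finset.card_univ, nsmul_eq_mul]

variable {n : ℕ} {p : unitInterval}

lemma setBernoulli_superset (F : Finset (Fin n)) :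
    setBernoulli (Set.univ : Set (Fin n)) p {s | ∀ x ∈ F, x ∈ s} =
      ENNReal.ofReal p ^ F.card := by
  rw [setBernoulli_apply']
  have hpre : (fun q : Fin n → Prop => {i | q i}) ⁻¹' {s : Set (Fin n) | ∀ x ∈ F, x ∈ s} =
      Set.pi (F : Set (Fin n)) fun _ => {True} := by
    ext q; simp
  rw [hpre, Measure.infinitePi_pi _ (fun _ _ => .of_discrete)]
  simp only [Set.mem_univ, Finset.prod_const]
  congr 1
  have hp : unitInterval.toNNReal p = Real.toNNReal p :=
    NNReal.eq (Real.coe_toNNReal _ p.2.1).symm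
  rw [Measure.add_apply, Measure.smul_apply, Measure.smul_apply,
    Measure.dirac_apply' _ .of_discrete, Measure.dirac_apply' _ .of_discrete, hp]
  simp [ENNReal.ofReal, ENNReal.smul_def]

lemma setBernoulli_mem (x : Fin n) :
    setBernoulli (Set.univ : Set (Fin n)) p {s | x ∈ s} = ENNReal.ofReal p := by
  simpa using setBernoulli_superset (p := p) {x}

/-- The law of the color lists. -/
noncomputable def listLaw (n : ℕ) (p : unitInterval) : Measure (Fin n → Set (Fin n)) :=
  Measure.pi fun _ : Fin n => setBernoulli (Set.univ : Set (Fin n)) p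

instance : IsProbabilityMeasure (listLaw n p) := by unfold listLaw; infer_instance

lemma listLaw_row (a : Fin n) (D : ℕ) :
    listLaw n p {S | D ≤ (S a).ncard} ≤ n.choose D * ENNReal.ofReal p ^ D := by
  have h := measure_le_ncard_le (listLaw n p) (fun x : Fin n => {S | x ∈ S a}) (ENNReal.ofReal p)
    (fun F => ?_) D
  · simpa using h
  · have hs : (⋂ x ∈ F, {S : Fin n → Set (Fin n) | x ∈ S a}) =
        Function.eval a ⁻¹' {s | ∀ x ∈ F, x ∈ s} := by ext; simp
    rw [hs, listLaw, (measurePreserving_eval _ a).measure_preimage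
      (Set.toFinite _).measurableSet.nullMeasurableSet, setBernoulli_superset]

lemma listLaw_col (x : Fin n) (D : ℕ) :
    listLaw n p {S | D ≤ {a | x ∈ S a}.ncard} ≤ n.choose D * ENNReal.ofReal p ^ D := by
  classical
  have h := measure_le_ncard_le (listLaw n p) (fun a : Fin n => {S | x ∈ S a}) (ENNReal.ofReal p)
    (fun F => ?_) D
  · simpa using h
  · have hs : (⋂ a ∈ F, {S : Fin n → Set (Fin n) | x ∈ S a}) =
        Set.pi Set.univ fun a => if a ∈ F then {s | x ∈ s} else Set.univ := by
      ext S
      simp only [Set.mem_iInter, Set.mem_ofPred_eq, Set.mem_pi, Set.mem_univ, true_imp_iff]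
      refine forall_congr' fun a => ?_
      by_cases ha : a ∈ F <;> simp [ha]
    rw [hs, listLaw, Measure.pi_pi]
    simp only [apply_ite, measure_univ, setBernoulli_mem]
    simp

/-- Some list or some color class has more than `D` elements. -/
def largeDegree (n D : ℕ) : Set (Fin n → Set (Fin n)) :=
  {S | ∃ a, D + 1 ≤ (S a).ncard} ∪ {S | ∃ x, D + 1 ≤ {a | x ∈ S a}.ncard}

lemma listLaw_largeDegree (D : ℕ) :
    listLaw n p (largeDegree n D) ≤
      2 * n * (n.choose (D + 1) * ENNReal.ofReal p ^ (D + 1)) := by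
  have h1 : listLaw n p {S | ∃ a, D + 1 ≤ (S a).ncard} ≤
      n * (n.choose (D + 1) * ENNReal.ofReal p ^ (D + 1)) := by
    rw [Set.ofPred_exists]
    refine (measure_iUnion_fintype_le _ _).trans
      ((Finset.sum_le_sum fun a _ => listLaw_row a (D + 1)).trans ?_)
    simp
  have h2 : listLaw n p {S | ∃ x, D + 1 ≤ {a | x ∈ S a}.ncard} ≤
      n * (n.choose (D + 1) * ENNReal.ofReal p ^ (D + 1)) := by
    rw [Set.ofPred_exists]
    refine (measure_iUnion_fintype_le _ _).trans
      ((Finset.sum_le_sum fun x _ => listLaw_col x (D + 1)).trans ?_)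
    simp
  refine (measure_union_le _ _).trans ((add_le_add h1 h2).trans_eq ?_)
  ring

/-- Resampling one coordinate of a product measure preserves it. -/
lemma measurePreserving_update_pi {ι : Type*} [Fintype ι] [DecidableEq ι] {X : ι → Type*}
    [∀ i, MeasurableSpace (X i)] (μ : ∀ i, Measure (X i)) [∀ i, IsProbabilityMeasure (μ i)]
    (i : ι) :
    MeasurePreserving (fun q : (∀ i, X i) × X i => Function.update q.1 i q.2)
      ((Measure.pi μ).prod (μ i)) (Measure.pi μ) := by
  have hm : Measurable fun q : (∀ i, X i) × X i => Function.update q.1 i q.2 := by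
    refine measurable_pi_iff.2 fun j => ?_
    rcases eq_or_ne j i with rfl | hj
    · simpa using measurable_snd
    · simp only [Function.update_of_ne hj]
      exact (measurable_pi_apply j).comp measurable_fst
  refine ⟨hm, (Measure.pi_eq fun s hs => ?_).symm⟩
  rw [Measure.map_apply hm (.univ_pi hs)]
  have : (fun q : (∀ i, X i) × X i => Function.update q.1 i q.2) ⁻¹' Set.pi Set.univ s =
      (Set.pi Set.univ (Function.update s i Set.univ)) ×ˢ s i := by
    ext q
    simp only [Set.mem_preimage, Set.mem_pi, Set.mem_univ, true_imp_iff, Set.mem_prod]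
    constructor
    · intro h
      refine ⟨fun j => ?_, by simpa using h i⟩
      rcases eq_or_ne j i with rfl | hj
      · simp
      · simpa [Function.update_of_ne hj] using h j
    · rintro ⟨h, h'⟩ j
      rcases eq_or_ne j i with rfl | hj
      · simpa using h'
      · simpa [Function.update_of_ne hj] using h j
  rw [this, Measure.prod_prod, Measure.pi_pi, ← Finset.prod_erase_mul _ _ (Finset.mem_univ i),
    ← Finset.prod_erase_mul (a := i) _ (fun j => μ j (s j)) (Finset.mem_univ i)]
  simp only [Function.update_self, measure_univ, mul_one]
  congr 1
  refine Finset.prod_congr rfl fun j hj => ?_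
  rw [Function.update_of_ne (Finset.ne_of_mem_erase hj)]

variable {Coin : Type*} [MeasurableSpace Coin] (ρ : Measure Coin) [IsProbabilityMeasure ρ]

instance : IsProbabilityMeasure (sampleLaw n p ρ) := by unfold sampleLaw; infer_instance

lemma measurePreserving_resample (v : Fin n) :
    MeasurePreserving
      (fun q : ((Fin n → Set (Fin n)) × (Fin n → Coin)) × Set (Fin n) =>
        (Function.update q.1.1 v q.2, q.1.2))
      ((sampleLaw n p ρ).prod (setBernoulli Set.univ p)) (sampleLaw n p ρ) := by
  have h1 := (measurePreserving_update_pi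
    (fun _ : Fin n => setBernoulli (Set.univ : Set (Fin n)) p) v).prod
    (MeasurePreserving.id (Measure.pi fun _ : Fin n => ρ))
  have h2 := (MeasurePreserving.id (listLaw n p)).prod (Measure.measurePreserving_swap
    (μ := Measure.pi fun _ : Fin n => ρ) (ν := setBernoulli (Set.univ : Set (Fin n)) p))
  exact h1.comp (((measurePreserving_prodAssoc _ _ _).symm _).comp
    (h2.comp (measurePreserving_prodAssoc _ _ _)))

/-- The new list `s` of `v` meets an old list near `v`. -/
def nearCollision (v : Fin n) (M : ℕ) : Set ((Fin n → Set (Fin n)) × Set (Fin n)) :=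
  {q | ¬ ∀ u ∈ ball (sparsified ⊤ q.1) v M, Disjoint q.2 (q.1 u)}

lemma setBernoulli_nearCollision (v : Fin n) (M D : ℕ) {S : Fin n → Set (Fin n)}
    (hS : S ∉ largeDegree n D) :
    setBernoulli Set.univ p {s | (S, s) ∈ nearCollision v M} ≤
      ((1 + D ^ 2) ^ M * D : ℕ) * ENNReal.ofReal p := by
  classical
  set U := ⋃ u ∈ ball (sparsified ⊤ S) v M, S u with hU
  simp only [largeDegree, Set.mem_union, Set.mem_ofPred_eq, not_or, not_exists, not_le,
    Nat.lt_succ_iff] at hS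
  have hsub : {s | (S, s) ∈ nearCollision v M} ⊆ ⋃ x ∈ U.toFinset, {s | x ∈ s} := by
    intro s hs
    simp only [nearCollision, Set.mem_ofPred_eq, not_forall, Set.not_disjoint_iff] at hs
    obtain ⟨u, hu, x, hxs, hxu⟩ := hs
    simp only [Set.mem_iUnion, Set.mem_toFinset, hU]
    exact ⟨x, ⟨u, hu, hxu⟩, hxs⟩
  refine (measure_mono hsub).trans ((measure_biUnion_finset_le _ _).trans ?_)
  simp only [setBernoulli_mem, Finset.sum_const, nsmul_eq_mul]
  gcongr
  rw [← Set.ncard_eq_toFinset_card']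
  exact ncard_colors_near_le hS.1 hS.2 v M

lemma measure_nearCollision_le (v : Fin n) (M D : ℕ) :
    ((sampleLaw n p ρ).prod (setBernoulli Set.univ p)) {q | (q.1.1, q.2) ∈ nearCollision v M} ≤
      2 * n * (n.choose (D + 1) * ENNReal.ofReal p ^ (D + 1)) +
        ((1 + D ^ 2) ^ M * D : ℕ) * ENNReal.ofReal p := by
  classical
  have hmeas : MeasurableSet {q : ((Fin n → Set (Fin n)) × (Fin n → Coin)) × Set (Fin n) |
      (q.1.1, q.2) ∈ nearCollision v M} :=
    (measurable_fst.fst.prodMk measurable_snd) (Set.toFinite (nearCollision v M)).measurableSet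
  have hL : MeasurableSet {ω : (Fin n → Set (Fin n)) × (Fin n → Coin) | ω.1 ∈ largeDegree n D} :=
    measurable_fst (Set.toFinite (largeDegree n D)).measurableSet
  rw [Measure.prod_apply hmeas]
  have hb : ∀ ω : (Fin n → Set (Fin n)) × (Fin n → Coin),
      setBernoulli Set.univ p (Prod.mk ω ⁻¹' {q | (q.1.1, q.2) ∈ nearCollision v M}) ≤
        Set.indicator {ω : (Fin n → Set (Fin n)) × (Fin n → Coin) | ω.1 ∈ largeDegree n D} 1 ω +
          ((1 + D ^ 2) ^ M * D : ℕ) * ENNReal.ofReal p := by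
    intro ω
    by_cases h : ω.1 ∈ largeDegree n D
    · rw [Set.indicator_of_mem (by exact h)]
      exact prob_le_one.trans le_self_add
    · exact (setBernoulli_nearCollision v M D h).trans le_add_self
  refine (lintegral_mono hb).trans ?_
  rw [lintegral_add_right _ measurable_const, lintegral_indicator_one hL, lintegral_const,
    measure_univ, mul_one]
  gcongr
  have : {ω : (Fin n → Set (Fin n)) × (Fin n → Coin) | ω.1 ∈ largeDegree n D} =
      largeDegree n D ×ˢ Set.univ := by ext; simp
  rw [this, sampleLaw, Measure.prod_prod, measure_univ, mul_one]
  exact listLaw_largeDegree D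

/-- A local algorithm that succeeds with probability `2/3` forces a collision near a resampled
node with probability `1/3`. -/
lemma one_third_le_measure_nearCollision {State Msg : Type*}
    (A : LocalAlgorithm (Set (Fin n)) (Fin n) Coin State Msg) (ident : Fin n → ℕ) (T : ℕ)
    (hm : MeasurableSet (successEvent A ident T))
    (hs : 2 / 3 ≤ sampleLaw n p ρ (successEvent A ident T)) (v : Fin n) :
    1 / 3 ≤ ((sampleLaw n p ρ).prod (setBernoulli Set.univ p))
      {q | (q.1.1, q.2) ∈ nearCollision v (2 * T + 3)} := by
  set Q := (sampleLaw n p ρ).prod (setBernoulli (Set.univ : Set (Fin n)) p)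
  set E := successEvent A ident T
  set R := fun q : ((Fin n → Set (Fin n)) × (Fin n → Coin)) × Set (Fin n) =>
        (Function.update q.1.1 v q.2, q.1.2)
  have hc : sampleLaw n p ρ Eᶜ ≤ 1 / 3 := by
    rw [prob_compl_eq_one_sub hm]
    refine (tsub_le_tsub_left hs 1).trans ?_
    rw [tsub_le_iff_right, ENNReal.div_add_div_same]
    norm_num
    rw [ENNReal.div_self] <;> norm_num
  have h1 : Q (Prod.fst ⁻¹' Eᶜ) ≤ 1 / 3 := by
    rw [(measurePreserving_fst).measure_preimage hm.compl.nullMeasurableSet]; exact hc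
  have h2 : Q (R ⁻¹' Eᶜ) ≤ 1 / 3 := by
    rw [(measurePreserving_resample ρ v).measure_preimage hm.compl.nullMeasurableSet]; exact hc
  have hcover : Set.univ ⊆ Prod.fst ⁻¹' Eᶜ ∪ R ⁻¹' Eᶜ ∪
      {q | (q.1.1, q.2) ∈ nearCollision v (2 * T + 3)} := by
    rintro q -
    by_contra hq
    simp only [Set.mem_union, not_or, Set.mem_preimage, Set.mem_compl_iff, not_not,
      Set.mem_ofPred_eq, nearCollision] at hq
    obtain ⟨⟨hq1, hq2⟩, hq3⟩ := hq
    refine not_isListColoring_of_resampled (v := v) A ident q.1.2 T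
      (S := q.1.1) (S' := Function.update q.1.1 v q.2)
      (fun a ha => (Function.update_of_ne ha _ _).symm) ?_ hq1 hq2
    simpa using hq3
  have h3 : 1 ≤ 1 / 3 + 1 / 3 + Q {q | (q.1.1, q.2) ∈ nearCollision v (2 * T + 3)} :=
    calc (1 : ℝ≥0∞) = Q Set.univ := measure_univ.symm
      _ ≤ _ := measure_mono hcover
      _ ≤ _ := (measure_union_le _ _).trans (add_le_add_left ((measure_union_le _ _).trans
        (add_le_add h1 h2)) _)
  have h4 : (1 : ℝ≥0∞) = 1 / 3 + 1 / 3 + 1 / 3 := by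
    rw [ENNReal.div_add_div_same, ENNReal.div_add_div_same]
    norm_num
    rw [ENNReal.div_self] <;> norm_num
  have h5 : (1 / 3 + 1 / 3 : ℝ≥0∞) ≠ ∞ := by finiteness
  exact (ENNReal.add_le_add_iff_left h5).1 (h4 ▸ h3)

lemma choose_mul_pow_le_exp {n d : ℕ} {p : ℝ} (hp : 0 ≤ p) (h : Real.exp 3 * (n * p) ≤ d) :
    (n.choose d : ℝ) * p ^ d ≤ Real.exp (-2 * d) := by
  have hd : (d : ℝ) ^ d / d ! ≤ Real.exp d := Real.pow_div_factorial_le_exp _ d.cast_nonneg d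
  have hnp : n * p ≤ Real.exp (-3) * d := by
    rw [Real.exp_neg, inv_mul_eq_div, le_div_iff₀ (Real.exp_pos _), mul_comm]
    exact h
  calc (n.choose d : ℝ) * p ^ d ≤ (n ^ d / d ! : ℝ) * p ^ d := by
        gcongr; exact Nat.choose_le_pow_div d n
    _ = (n * p) ^ d / d ! := by rw [mul_pow]; ring
    _ ≤ (Real.exp (-3) * d) ^ d / d ! := by gcongr
    _ = Real.exp (-3) ^ d * ((d : ℝ) ^ d / d !) := by rw [mul_pow]; ring
    _ ≤ Real.exp (-3) ^ d * Real.exp d := by gcongr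
    _ = Real.exp (-2 * d) := by
        rw [← Real.exp_nat_mul, ← Real.exp_add]; congr 1; ring

/-- The numerical estimate behind the lower bound, in terms of `L = log n`. -/
lemma collision_bound_lt {L f p : ℝ} {m n T : ℕ} (hL : 40 ≤ L) (hn : (n : ℝ) = Real.exp L)
    (hf : 0 ≤ f) (hfL : Real.exp 3 * f ≤ L ^ m) (hm : 1 ≤ m) (hp : p = f / n)
    (hlog : 16 * (2 * m + 1) * Real.log L ≤ L)
    (hT : T * Real.log L ≤ 1 / (4 * (2 * m + 1)) * L) :
    2 * n * (n.choose (⌊L ^ m⌋₊ + 1) * p ^ (⌊L ^ m⌋₊ + 1)) +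
      ((1 + (⌊L ^ m⌋₊ : ℝ) ^ 2) ^ (2 * T + 3) * ⌊L ^ m⌋₊) * p < 1 / 3 := by
  set D := ⌊L ^ m⌋₊ with hD
  have hL0 : 0 < L := by linarith
  have hn0 : (0 : ℝ) < n := hn ▸ Real.exp_pos L
  have hDle : (D : ℝ) ≤ L ^ m := Nat.floor_le (by positivity)
  have hDlt : L ^ m < (D : ℝ) + 1 := Nat.lt_floor_add_one _
  have hLm : L ≤ L ^ m := le_self_pow₀ (by linarith) (by omega)
  have hnp : n * p = f := by rw [hp]; field_simp
  have hp0 : 0 ≤ p := hp ▸ by positivity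
  have hfm : f ≤ L ^ m := by
    have : (1 : ℝ) ≤ Real.exp 3 := Real.one_le_exp (by norm_num)
    nlinarith
  have hdecay : Real.exp (-(L / 4)) ≤ 1 / 11 := by
    rw [Real.exp_neg, inv_eq_one_div]
    have := Real.add_one_le_exp (L / 4)
    gcongr
    linarith
  have h1 : 2 * n * (n.choose (D + 1) * p ^ (D + 1)) ≤ 2 * Real.exp (-(L / 4)) := by
    have h := choose_mul_pow_le_exp (n := n) (d := D + 1) hp0 (by rw [hnp]; push_cast; linarith)
    calc 2 * n * (n.choose (D + 1) * p ^ (D + 1))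
        ≤ 2 * Real.exp L * Real.exp (-2 * (D + 1 : ℕ)) := by rw [← hn]; gcongr
      _ = 2 * Real.exp (L + -2 * (D + 1 : ℕ)) := by rw [Real.exp_add]; ring
      _ ≤ 2 * Real.exp (-(L / 4)) := by gcongr; push_cast; linarith
  have h2 : ((1 + (D : ℝ) ^ 2) ^ (2 * T + 3) * D) * p ≤ Real.exp (-(L / 4)) := by
    have hpL : p ≤ L ^ m * Real.exp (-L) := by
      rw [hp, hn, Real.exp_neg, div_eq_mul_inv]; gcongr
    have hbase : 1 + (L ^ m) ^ 2 ≤ L ^ (2 * m + 1) := by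
      have h1 : 1 ≤ (L ^ m) ^ 2 := one_le_pow₀ (by linarith)
      have : L ^ (2 * m + 1) = (L ^ m) ^ 2 * L := by ring
      nlinarith
    calc ((1 + (D : ℝ) ^ 2) ^ (2 * T + 3) * D) * p
        ≤ ((1 + (L ^ m) ^ 2) ^ (2 * T + 3) * L ^ m) * (L ^ m * Real.exp (-L)) := by gcongr
      _ = ((1 + (L ^ m) ^ 2) ^ (2 * T + 3) * (L ^ m) ^ 2) * Real.exp (-L) := by ring
      _ ≤ ((1 + (L ^ m) ^ 2) ^ (2 * T + 3) * (1 + (L ^ m) ^ 2)) * Real.exp (-L) := by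
          gcongr; linarith
      _ = (1 + (L ^ m) ^ 2) ^ (2 * T + 4) * Real.exp (-L) := by ring
      _ ≤ (L ^ (2 * m + 1)) ^ (2 * T + 4) * Real.exp (-L) := by gcongr
      _ = Real.exp ((2 * m + 1) * (2 * T + 4) * Real.log L + -L) := by
          rw [Real.exp_add, ← pow_mul]
          congr 1
          rw [← Real.exp_log (pow_pos hL0 _), Real.log_pow]
          push_cast
          rfl
      _ ≤ Real.exp (-(L / 4)) := by
          gcongr
          have ha : (0 : ℝ) < 2 * m + 1 := by positivity
          have h3 : (2 * m + 1) * (T * Real.log L) ≤ L / 4 := by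
            calc (2 * m + 1) * (T * Real.log L)
                ≤ (2 * m + 1) * (1 / (4 * (2 * m + 1)) * L) := by gcongr
              _ = L / 4 := by field_simp
          linarith
  linarith

end PaletteSparsification

open PaletteSparsification in
theorem mainTheorem2 :
    ∃ c : ℝ, 0 < c ∧
      ∀ (K : ℝ) (k : ℕ), ∃ η : ℝ, 0 < η ∧ ∃ N : ℕ,
        ∀ (f : ℕ → ℝ) (n : ℕ), N ≤ n →
          c * Real.log n ≤ f n → f n ≤ K * Real.log n ^ k →
          ∀ p : unitInterval, (p : ℝ) = f n / n →
          ∀ (Coin : Type*) [MeasurableSpace Coin] (ρ : Measure Coin) [IsProbabilityMeasure ρ]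
            (State Msg : Type*)
            (A : PaletteSparsification.LocalAlgorithm (Set (Fin n)) (Fin n) Coin State Msg)
            (ident : Fin n → ℕ) (T : ℕ),
            Function.Injective ident →
            MeasurableSet (PaletteSparsification.successEvent A ident T) →
            2 / 3 ≤ PaletteSparsification.sampleLaw n p ρ
              (PaletteSparsification.successEvent A ident T) →
            η * (Real.log n / Real.log (Real.log n)) ≤ T := by
  refine ⟨1, one_pos, fun K k => ⟨1 / (4 * (2 * (k + 1 : ℕ) + 1)), by positivity, ?_⟩⟩
  have hlim : Filter.Tendsto (fun n : ℕ => Real.log n) Filter.atTop Filter.atTop :=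
    Real.tendsto_log_atTop.comp tendsto_natCast_atTop_atTop
  have hsmall : ∀ᶠ L : ℝ in Filter.atTop, 16 * (2 * ((k + 1 : ℕ) : ℝ) + 1) * Real.log L ≤ L := by
    set a := 16 * (2 * ((k + 1 : ℕ) : ℝ) + 1) with ha
    have ha0 : 0 < a := by positivity
    filter_upwards [Real.isLittleO_log_id_atTop.bound (inv_pos.2 ha0), Filter.eventually_ge_atTop 1]
      with L h hL
    rw [Real.norm_of_nonneg (Real.log_nonneg hL), id, Real.norm_of_nonneg (by linarith)] at h
    calc a * Real.log L ≤ a * (a⁻¹ * L) := by gcongr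
      _ = L := by field_simp
  obtain ⟨N, hN⟩ := Filter.eventually_atTop.1 ((hlim.eventually hsmall).and
    ((hlim.eventually_ge_atTop (max 40 (Real.exp 3 * K))).and (Filter.eventually_ge_atTop 1)))
  refine ⟨N, fun f n hn hfl hfu p hp Coin _ ρ _ State Msg A ident T _ hmeas hsucc => ?_⟩
  obtain ⟨hlog, hL, hn1⟩ := hN n hn
  have hL40 := (le_max_left _ _).trans hL
  have hLK := (le_max_right _ _).trans hL
  have hn0 : (0 : ℝ) < n := by exact_mod_cast hn1
  set L := Real.log n with hLdef
  have hLL : 0 < Real.log L := Real.log_pos (by linarith)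
  by_contra! hT
  have hT' : T * Real.log L ≤ 1 / (4 * (2 * ((k + 1 : ℕ) : ℝ) + 1)) * L := by
    rw [← mul_div_assoc, lt_div_iff₀ hLL] at hT
    exact hT.le
  have hfm : Real.exp 3 * f n ≤ L ^ (k + 1) :=
    calc Real.exp 3 * f n ≤ Real.exp 3 * (K * L ^ k) := by gcongr
      _ = (Real.exp 3 * K) * L ^ k := by ring
      _ ≤ L * L ^ k := by gcongr
      _ = L ^ (k + 1) := by ring
  have hb := collision_bound_lt hL40 (Real.exp_log hn0).symm (by linarith) hfm (by omega) hp
    hlog hT'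
  have h3 := (one_third_le_measure_nearCollision ρ A ident T hmeas hsucc ⟨0, hn1⟩).trans
    (measure_nearCollision_le ρ ⟨0, hn1⟩ (2 * T + 3) ⌊L ^ (k + 1)⌋₊)
  have hp0 : 0 ≤ (p : ℝ) := p.2.1
  refine absurd h3 (not_le.2 ?_)
  convert (ENNReal.ofReal_lt_ofReal_iff (by norm_num)).2 hb using 1
  · rw [ENNReal.ofReal_add (by positivity) (by positivity)]
    congr 1
    · rw [ENNReal.ofReal_mul (by positivity), ENNReal.ofReal_mul (by positivity),
        ENNReal.ofReal_mul (by positivity), ENNReal.ofReal_pow hp0]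
      simp
    · rw [ENNReal.ofReal_mul (by positivity)]
      congr 1
      rw [← ENNReal.ofReal_natCast]
      push_cast
      rfl
  · rw [ENNReal.ofReal_div_of_pos (by norm_num)]
    simp
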